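/- Let $S=\mathbb{C}[x,y,z]$ and let $\mathrm{Der}(S)$ be the free $S$-module of $\mathbb{C}$-linear derivations $a\partial_x+b\partial_y+c\partial_z$ of $S$, graded by the polynomial degree of the coefficients $a,b,c\in S$. For a reduced curve $C: F=0$ in the complex projective plane, put $$D(F)=\{\delta\in \mathrm{Der}(S): \delta F\in\langle F\rangle\},\qquad D_0(F)=\{\delta\in \mathrm{Der}(S): \delta F=0\}.$$ The curve $C$ is called free if $D(F)$ is a free graded $S$-module (equivalently, $D_0(F)$ is a free graded $S$-module, which then has rank $2$); its exponents $(d_1,d_2)$ are then the degrees of the two elements of a homogeneous basis of $D_0(F)$. Let $m\ge 2$ be an integer. Then the curve $$C': (x^my^m+y^mz^m+x^mz^m)(x^m+y^m)(y^m+z^m)=0$$ is reduced of degree $4m$, and it is free with exponents $(2m-1,2m)$. The curve $$C'': yz(x^my^m+y^mz^m+x^mz^m)(y^m+z^m)=0$$ is reduced of degree $3m+2$, and it is free with exponents $(m+1,2m)$. -/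

import Mathlib

open MvPolynomial

namespace PlaneCurve

/-- The polynomial ring `S = ℂ[x, y, z]`, with `x = X 0`, `y = X 1`, `z = X 2`. -/
abbrev S : Type := MvPolynomial (Fin 3) ℂ

/-- The `S`-module `Der(S)` of `ℂ`-linear derivations `a ∂x + b ∂y + c ∂z` of `S`
(the coefficients being the values at `x`, `y`, `z`). -/
abbrev Der : Type := Derivation ℂ S S

/-- `F = 0` is a reduced plane curve of degree `d` in the complex projective plane: `F` is
a nonzero form of degree `d` without multiple factors (`Squarefree F` forces `F ≠ 0`). -/
def IsReducedCurve (F : S) (d : ℕ) : Prop :=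
  F.IsHomogeneous d ∧ Squarefree F

/-- `D(F)`: the derivations preserving the ideal `⟨F⟩`. -/
def derLog (F : S) : Submodule S Der where
  carrier := {δ | δ F ∈ Ideal.span {F}}
  add_mem' := fun ha hb => by
    simpa using Ideal.add_mem _ ha hb
  zero_mem' := by simp
  smul_mem' := fun c δ h => by
    simpa using Ideal.mul_mem_left _ c h

/-- `D₀(F)`: the derivations killing `F`. -/
def derKill (F : S) : Submodule S Der where
  carrier := {δ | δ F = 0}
  add_mem' := fun {a b} ha hb => by
    simp only [Set.mem_ofPred_eq] at ha hb ⊢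
    simp [ha, hb]
  zero_mem' := by simp
  smul_mem' := fun c δ h => by
    simp only [Set.mem_ofPred_eq] at h ⊢
    simp [h]

/-- `a ∂x + b ∂y + c ∂z` is homogeneous of degree `k` in the grading of `Der(S)` by the
polynomial degree of the coefficients `a`, `b`, `c`. -/
def IsHomogeneousDer (δ : Der) (k : ℕ) : Prop :=
  ∀ i : Fin 3, (δ (X i)).IsHomogeneous k

/-- The graded submodule `M` of `Der(S)` is graded free, with an `S`-basis of homogeneous
elements of degrees `e 0, …, e (n - 1)`. -/
def IsGradedFree (M : Submodule S Der) {n : ℕ} (e : Fin n → ℕ) : Prop :=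
  ∃ b : Module.Basis (Fin n) S M, ∀ i, IsHomogeneousDer (b i : Der) (e i)

/-- The curve `F = 0` is free: `D(F)` is a free graded `S`-module. -/
def IsFree (F : S) : Prop :=
  ∃ (n : ℕ) (e : Fin n → ℕ), IsGradedFree (derLog F) e

/-- The exponents of the curve `F = 0` are `(d₁, d₂)`: the free graded `S`-module `D₀(F)` has
a homogeneous basis of two elements, of degrees `d₁` and `d₂`. -/
def HasExponents (F : S) (d₁ d₂ : ℕ) : Prop :=
  IsGradedFree (derKill F) ![d₁, d₂]

/-- `x^m y^m + y^m z^m + x^m z^m` -/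
noncomputable def base (m : ℕ) : S :=
  X 0 ^ m * X 1 ^ m + X 1 ^ m * X 2 ^ m + X 0 ^ m * X 2 ^ m

end PlaneCurve

/-! A Saito-type criterion carries the proof. If the coefficient vectors of two derivations have
cross product a unit times the gradient of `F`, both kill `F`, since a triple product with a
repeated vector vanishes. For reduced `F` the partials have no common factor, so the cross product
of any two elements of `D₀(F)` is a multiple of the gradient; Cramer's rule then makes the pair a
basis (`CrossEqGradient.hasExponents`). Adjoining the Euler derivation gives a basis of `D(F)`
(`CrossEqGradient.isFree`). It remains to check that both curves are reduced and to exhibit the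
pairs (`crossEqGradient_left`, `crossEqGradient_right`). -/

namespace PlaneCurve

/-! ### Derivations, gradients and repeated factors. -/

theorem der_apply (δ : Der) (f : S) : δ f = ∑ i, δ (X i) * pderiv i f := by
  have h : δ = ∑ i, δ (X i) • (pderiv i : Der) := by
    refine derivation_ext fun j => ?_
    fin_cases j <;> simp [Fin.sum_univ_three, pderiv_X]
  conv_lhs => rw [h]
  simp [Fin.sum_univ_three]

theorem der_apply_eq (δ : Der) (f : S) : δ f =
    δ (X 0) * pderiv 0 f + δ (X 1) * pderiv 1 f + δ (X 2) * pderiv 2 f := by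
  rw [der_apply, Fin.sum_univ_three]

/-- A nonzero derivative has smaller degree in `X i` than `p`, while a nonzero multiple of `p` does
not. -/
theorem pderiv_eq_zero_of_dvd {p : S} {i : Fin 3} (h : p ∣ pderiv i p) : pderiv i p = 0 := by
  by_contra hne
  have hp : p ≠ 0 := by
    rintro rfl
    simp at hne
  obtain ⟨q, hq⟩ := h
  have hq0 : q ≠ 0 := by
    rintro rfl
    simp [hq] at hne
  have hdeg : degreeOf i p ≠ 0 := by
    intro h0
    apply hne
    apply pderiv_eq_zero_of_notMem_vars
    rw [mem_vars_iff_degreeOf_ne_zero]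
    simpa using h0
  have hlt : degreeOf i (pderiv i p) < degreeOf i p := by
    rw [degreeOf_lt_iff (Nat.pos_of_ne_zero hdeg)]
    intro n hn
    rw [mem_support_iff, coeff_pderiv] at hn
    have h1 := monomial_le_degreeOf i (mem_support_iff.mpr (left_ne_zero_of_mul hn))
    simp at h1
    omega
  rw [hq, degreeOf_mul_eq hp hq0] at hlt
  omega

theorem exists_eq_C_of_pderiv_eq_zero {p : S} (h : ∀ i, pderiv i p = 0) : ∃ a, p = C a := by
  refine ⟨coeff 0 p, ?_⟩
  ext n
  rw [coeff_C]
  split_ifs with hn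
  · rw [hn]
  · obtain ⟨i, hi⟩ := Finsupp.ne_iff.mp (Ne.symm hn)
    have h1 := coeff_pderiv (i := i) p (n - Finsupp.single i 1)
    rw [h i, coeff_zero, tsub_add_cancel_of_le
      (by simpa [Nat.one_le_iff_ne_zero] using hi)] at h1
    rcases mul_eq_zero.mp h1.symm with h2 | h2
    · exact h2
    · exact absurd h2 (Nat.cast_add_one_ne_zero _)

theorem isUnit_of_dvd_pderiv {p : S} (hp : p ≠ 0) (h : ∀ i, p ∣ pderiv i p) : IsUnit p := by
  obtain ⟨a, rfl⟩ := exists_eq_C_of_pderiv_eq_zero fun i => pderiv_eq_zero_of_dvd (h i)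
  have ha : a ≠ 0 := by
    rintro rfl
    simp at hp
  exact (isUnit_iff_ne_zero.mpr ha).map C

/-- If `F = p * G` with `p ∤ G`, the Leibniz rule forces `p` to divide all its own partials, so `p`
would be constant. -/
theorem not_squarefree_of_dvd_pderiv {F p : S} (hp : Irreducible p) (hF : p ∣ F)
    (h : ∀ i, p ∣ pderiv i F) : ¬ Squarefree F := by
  intro hsq
  obtain ⟨G, rfl⟩ := hF
  have hG : ¬ p ∣ G := fun hG => hp.not_isUnit (hsq p (mul_dvd_mul_left p hG))
  refine hp.not_isUnit (isUnit_of_dvd_pderiv hp.ne_zero fun i => ?_)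
  have h1 := h i
  rw [Derivation.leibniz, smul_eq_mul, smul_eq_mul, dvd_add_right (dvd_mul_right _ _)] at h1
  exact (hp.prime.dvd_or_dvd h1).resolve_left hG

theorem squarefree_of_pderiv {F : S} (hF : F ≠ 0)
    (h : ∀ p : S, Prime p → p ∣ F → (∀ i, p ∣ pderiv i F) → False) : Squarefree F := by
  rw [squarefree_iff_irreducible_sq_not_dvd_of_ne_zero hF]
  rintro p hp ⟨G, rfl⟩
  refine h p hp.prime ⟨p * G, by ring⟩ fun i => ?_
  refine ⟨pderiv i p * G + pderiv i (p * G), ?_⟩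
  rw [mul_assoc, Derivation.leibniz]
  simp only [smul_eq_mul]
  ring

theorem pderiv_ne_zero {F : S} {d : ℕ} (hF : IsReducedCurve F d) (hd : d ≠ 0) :
    ∃ i, pderiv i F ≠ 0 := by
  by_contra! h
  have h1 := hF.1.sum_X_mul_pderiv
  simp only [h, mul_zero, Finset.sum_const_zero] at h1
  exact smul_ne_zero hd hF.2.ne_zero h1.symm

theorem isUnit_natCast {d : ℕ} (hd : d ≠ 0) : IsUnit (d : S) := by
  have := (isUnit_iff_ne_zero.mpr (Nat.cast_ne_zero.mpr hd : (d : ℂ) ≠ 0)).map (C : ℂ →+* S)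
  simpa using this

/-- By Euler's identity a prime dividing all partials also divides `F`, hence is a repeated factor.
-/
theorem isUnit_of_dvd_gradient {F : S} {d : ℕ} (hF : IsReducedCurve F d) (hd : d ≠ 0) {q : S}
    (hq : ∀ i, q ∣ pderiv i F) : IsUnit q := by
  have hq0 : q ≠ 0 := by
    rintro rfl
    obtain ⟨i, hi⟩ := pderiv_ne_zero hF hd
    exact hi (zero_dvd_iff.mp (hq i))
  by_contra hu
  obtain ⟨p, hp, hpq⟩ := WfDvdMonoid.exists_irreducible_factor hu hq0
  have hdiv : ∀ i, p ∣ pderiv i F := fun i => hpq.trans (hq i)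
  refine not_squarefree_of_dvd_pderiv hp ?_ hdiv hF.2
  have h1 : p ∣ d • F := by
    rw [← hF.1.sum_X_mul_pderiv]
    exact Finset.dvd_sum fun i _ => (hdiv i).mul_left _
  rw [nsmul_eq_mul] at h1
  exact (isUnit_natCast hd).dvd_mul_left.mp h1

/-- A vector parallel to a vector whose entries have no common factor is a multiple of it. -/
theorem exists_eq_mul_of_parallel {R ι : Type*} [CommRing R] [IsDomain R]
    [UniqueFactorizationMonoid R] {g u : ι → R}
    (hg : ∀ q, (∀ i, q ∣ g i) → IsUnit q) (hne : ∃ i, g i ≠ 0)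
    (h : ∀ i j, g i * u j = g j * u i) : ∃ a, ∀ i, u i = a * g i := by
  obtain ⟨i, hi⟩ := hne
  obtain ⟨a, b, c, hab, hca, hcb⟩ := UniqueFactorizationMonoid.exists_reduced_factors (g i) hi (u i)
  have hc : c ≠ 0 := by
    rintro rfl
    simp [← hca] at hi
  -- In lowest terms `u i / g i = b / a`, and every `u j / g j` is the same fraction; so `a` divides
  -- every `g j` and is a unit.
  have key : ∀ j, a * u j = g j * b := fun j => by
    apply mul_left_cancel₀ hc
    rw [← mul_assoc, hca, h, ← hcb]
    ring
  obtain ⟨e, he⟩ := (hg a fun j => hab.dvd_of_dvd_mul_right ⟨u j, (key j).symm⟩).exists_left_inv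
  refine ⟨e * b, fun j => ?_⟩
  calc u j = e * a * u j := by rw [he, one_mul]
    _ = e * b * g j := by rw [mul_assoc, key]; ring

/-! ### The cross product criterion for freeness. -/

theorem isGradedFree_of_span {M : Submodule S Der} {n : ℕ} {e : Fin n → ℕ} (v : Fin n → Der)
    (hli : LinearIndependent S v) (hM : Submodule.span S (Set.range v) = M)
    (hv : ∀ i, IsHomogeneousDer (v i) (e i)) : IsGradedFree M e := by
  subst hM
  refine ⟨Module.Basis.span hli, fun i => ?_⟩
  rw [Module.Basis.span_apply]
  exact hv i

/-- The cross product of `δ₁` and `δ₂` is `c` times the gradient of `F`. -/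
structure CrossEqGradient (F : S) (δ₁ δ₂ : Der) (c : S) : Prop where
  zero : δ₁ (X 1) * δ₂ (X 2) - δ₁ (X 2) * δ₂ (X 1) = c * pderiv 0 F
  one : δ₁ (X 2) * δ₂ (X 0) - δ₁ (X 0) * δ₂ (X 2) = c * pderiv 1 F
  two : δ₁ (X 0) * δ₂ (X 1) - δ₁ (X 1) * δ₂ (X 0) = c * pderiv 2 F

namespace CrossEqGradient

variable {F : S} {δ₁ δ₂ : Der} {c : S}

theorem left_mem (h : CrossEqGradient F δ₁ δ₂ c) (hc : IsUnit c) : δ₁ ∈ derKill F := by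
  change δ₁ F = 0
  apply hc.mul_right_eq_zero.mp
  rw [der_apply_eq]
  linear_combination -δ₁ (X 0) * h.zero - δ₁ (X 1) * h.one - δ₁ (X 2) * h.two

theorem right_mem (h : CrossEqGradient F δ₁ δ₂ c) (hc : IsUnit c) : δ₂ ∈ derKill F := by
  change δ₂ F = 0
  apply hc.mul_right_eq_zero.mp
  rw [der_apply_eq]
  linear_combination -δ₂ (X 0) * h.zero - δ₂ (X 1) * h.one - δ₂ (X 2) * h.two

theorem eq_zero_of_parallel (h : CrossEqGradient F δ₁ δ₂ c) (hc : IsUnit c)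
    (hF : ∃ i, pderiv i F ≠ 0) {v : Fin 3 → S}
    (h1 : ∀ i j, v i * δ₁ (X j) = v j * δ₁ (X i))
    (h2 : ∀ i j, v i * δ₂ (X j) = v j * δ₂ (X i)) (i : Fin 3) : v i = 0 := by
  have key : ∀ j k, v i * (δ₁ (X j) * δ₂ (X k) - δ₁ (X k) * δ₂ (X j)) = 0 := fun j k => by
    linear_combination δ₂ (X k) * h1 i j - δ₂ (X j) * h1 i k + δ₁ (X i) * h2 j k
  obtain ⟨l, hl⟩ := hF
  have hv : v i * (c * pderiv l F) = 0 := by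
    fin_cases l
    · exact h.zero ▸ key 1 2
    · exact h.one ▸ key 2 0
    · exact h.two ▸ key 0 1
  exact (mul_eq_zero.mp hv).resolve_right (mul_ne_zero hc.ne_zero hl)

theorem pair_independent (h : CrossEqGradient F δ₁ δ₂ c) (hc : IsUnit c)
    (hF : ∃ i, pderiv i F ≠ 0) {a b : S} (hab : a • δ₁ + b • δ₂ = 0) : a = 0 ∧ b = 0 := by
  have e : ∀ i, a * δ₁ (X i) + b * δ₂ (X i) = 0 := fun i => by
    simpa using DFunLike.congr_fun hab (X i)
  have key : ∀ j k, a * (δ₁ (X j) * δ₂ (X k) - δ₁ (X k) * δ₂ (X j)) = 0 ∧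
      b * (δ₁ (X j) * δ₂ (X k) - δ₁ (X k) * δ₂ (X j)) = 0 := fun j k =>
    ⟨by linear_combination δ₂ (X k) * e j - δ₂ (X j) * e k,
      by linear_combination δ₁ (X j) * e k - δ₁ (X k) * e j⟩
  obtain ⟨l, hl⟩ := hF
  have hv : a * (c * pderiv l F) = 0 ∧ b * (c * pderiv l F) = 0 := by
    fin_cases l
    · exact h.zero ▸ key 1 2
    · exact h.one ▸ key 2 0
    · exact h.two ▸ key 0 1
  have hne := mul_ne_zero hc.ne_zero hl
  exact ⟨(mul_eq_zero.mp hv.1).resolve_right hne, (mul_eq_zero.mp hv.2).resolve_right hne⟩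

/-- Cramer's rule: `δ × δ₂ = a ∇F` and `δ₁ × δ = b ∇F`, so `c δ - a δ₁ - b δ₂` is parallel to both
`δ₁` and `δ₂` and therefore zero. -/
theorem exists_eq_combination (h : CrossEqGradient F δ₁ δ₂ c) (hc : IsUnit c) {d : ℕ}
    (hF : IsReducedCurve F d) (hd : d ≠ 0) {δ : Der} (hδ : δ F = 0) :
    ∃ a b : S, δ = a • δ₁ + b • δ₂ := by
  have hne := pderiv_ne_zero hF hd
  have hpar : ∀ ε₁ ε₂ : Der, ε₁ F = 0 → ε₂ F = 0 → ∃ a : S,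
      ε₁ (X 1) * ε₂ (X 2) - ε₁ (X 2) * ε₂ (X 1) = a * pderiv 0 F ∧
      ε₁ (X 2) * ε₂ (X 0) - ε₁ (X 0) * ε₂ (X 2) = a * pderiv 1 F ∧
      ε₁ (X 0) * ε₂ (X 1) - ε₁ (X 1) * ε₂ (X 0) = a * pderiv 2 F := by
    intro ε₁ ε₂ h₁ h₂
    rw [der_apply_eq] at h₁ h₂
    obtain ⟨a, ha⟩ := exists_eq_mul_of_parallel (g := fun i => pderiv i F)
      (u := ![ε₁ (X 1) * ε₂ (X 2) - ε₁ (X 2) * ε₂ (X 1),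
        ε₁ (X 2) * ε₂ (X 0) - ε₁ (X 0) * ε₂ (X 2),
        ε₁ (X 0) * ε₂ (X 1) - ε₁ (X 1) * ε₂ (X 0)])
      (fun q hq => isUnit_of_dvd_gradient hF hd hq) hne (by
        have h01 : pderiv 0 F * (ε₁ (X 2) * ε₂ (X 0) - ε₁ (X 0) * ε₂ (X 2)) =
            pderiv 1 F * (ε₁ (X 1) * ε₂ (X 2) - ε₁ (X 2) * ε₂ (X 1)) := by
          linear_combination ε₁ (X 2) * h₂ - ε₂ (X 2) * h₁
        have h02 : pderiv 0 F * (ε₁ (X 0) * ε₂ (X 1) - ε₁ (X 1) * ε₂ (X 0)) =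
            pderiv 2 F * (ε₁ (X 1) * ε₂ (X 2) - ε₁ (X 2) * ε₂ (X 1)) := by
          linear_combination ε₂ (X 1) * h₁ - ε₁ (X 1) * h₂
        have h12 : pderiv 1 F * (ε₁ (X 0) * ε₂ (X 1) - ε₁ (X 1) * ε₂ (X 0)) =
            pderiv 2 F * (ε₁ (X 2) * ε₂ (X 0) - ε₁ (X 0) * ε₂ (X 2)) := by
          linear_combination ε₁ (X 0) * h₂ - ε₂ (X 0) * h₁
        intro i j
        fin_cases i <;> fin_cases j
        exacts [rfl, h01, h02, h01.symm, rfl, h12, h02.symm, h12.symm, rfl])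
    exact ⟨a, ha 0, ha 1, ha 2⟩
  obtain ⟨a, a0, a1, a2⟩ := hpar δ δ₂ hδ (h.right_mem hc)
  obtain ⟨b, b0, b1, b2⟩ := hpar δ₁ δ (h.left_mem hc) hδ
  have hz := h.eq_zero_of_parallel hc hne
    (v := fun i => c * δ (X i) - a * δ₁ (X i) - b * δ₂ (X i)) (by
      have h01 : (c * δ (X 0) - a * δ₁ (X 0) - b * δ₂ (X 0)) * δ₁ (X 1) =
          (c * δ (X 1) - a * δ₁ (X 1) - b * δ₂ (X 1)) * δ₁ (X 0) := by
        linear_combination -c * b2 + b * h.two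
      have h02 : (c * δ (X 0) - a * δ₁ (X 0) - b * δ₂ (X 0)) * δ₁ (X 2) =
          (c * δ (X 2) - a * δ₁ (X 2) - b * δ₂ (X 2)) * δ₁ (X 0) := by
        linear_combination c * b1 - b * h.one
      have h12 : (c * δ (X 1) - a * δ₁ (X 1) - b * δ₂ (X 1)) * δ₁ (X 2) =
          (c * δ (X 2) - a * δ₁ (X 2) - b * δ₂ (X 2)) * δ₁ (X 1) := by
        linear_combination -c * b0 + b * h.zero
      intro i j
      fin_cases i <;> fin_cases j
      exacts [rfl, h01, h02, h01.symm, rfl, h12, h02.symm, h12.symm, rfl]) (by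
      have h01 : (c * δ (X 0) - a * δ₁ (X 0) - b * δ₂ (X 0)) * δ₂ (X 1) =
          (c * δ (X 1) - a * δ₁ (X 1) - b * δ₂ (X 1)) * δ₂ (X 0) := by
        linear_combination c * a2 - a * h.two
      have h02 : (c * δ (X 0) - a * δ₁ (X 0) - b * δ₂ (X 0)) * δ₂ (X 2) =
          (c * δ (X 2) - a * δ₁ (X 2) - b * δ₂ (X 2)) * δ₂ (X 0) := by
        linear_combination -c * a1 + a * h.one
      have h12 : (c * δ (X 1) - a * δ₁ (X 1) - b * δ₂ (X 1)) * δ₂ (X 2) =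
          (c * δ (X 2) - a * δ₁ (X 2) - b * δ₂ (X 2)) * δ₂ (X 1) := by
        linear_combination c * a0 - a * h.zero
      intro i j
      fin_cases i <;> fin_cases j
      exacts [rfl, h01, h02, h01.symm, rfl, h12, h02.symm, h12.symm, rfl])
  obtain ⟨e, he⟩ := hc.exists_left_inv
  refine ⟨e * a, e * b, derivation_ext fun i => ?_⟩
  simp only [Derivation.coe_add, Derivation.coe_smul, Pi.add_apply, Pi.smul_apply, smul_eq_mul]
  linear_combination e * hz i - δ (X i) * he

theorem hasExponents (h : CrossEqGradient F δ₁ δ₂ c) (hc : IsUnit c) {d d₁ d₂ : ℕ}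
    (hF : IsReducedCurve F d) (hd : d ≠ 0) (hδ₁ : IsHomogeneousDer δ₁ d₁)
    (hδ₂ : IsHomogeneousDer δ₂ d₂) : HasExponents F d₁ d₂ := by
  refine isGradedFree_of_span ![δ₁, δ₂] ?_ ?_ ?_
  · refine LinearIndependent.pair_iff.mpr fun s t hst => ?_
    exact h.pair_independent hc (pderiv_ne_zero hF hd) hst
  · refine le_antisymm (Submodule.span_le.mpr ?_) fun δ hδ => ?_
    · rintro _ ⟨i, rfl⟩
      fin_cases i
      exacts [h.left_mem hc, h.right_mem hc]
    · obtain ⟨s, t, rfl⟩ := h.exists_eq_combination hc hF hd hδ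
      exact add_mem (Submodule.smul_mem _ _ (Submodule.subset_span ⟨0, rfl⟩))
        (Submodule.smul_mem _ _ (Submodule.subset_span ⟨1, rfl⟩))
  · intro i
    fin_cases i
    exacts [hδ₁, hδ₂]

end CrossEqGradient

/-- The Euler derivation `x ∂x + y ∂y + z ∂z`. -/
noncomputable def euler : Der := mkDerivation ℂ X

theorem euler_apply {F : S} {d : ℕ} (hF : F.IsHomogeneous d) : euler F = d * F := by
  rw [der_apply, ← nsmul_eq_mul, ← hF.sum_X_mul_pderiv]
  simp [euler, mkDerivation_X]

theorem CrossEqGradient.isFree {F : S} {δ₁ δ₂ : Der} {c : S} (h : CrossEqGradient F δ₁ δ₂ c)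
    (hc : IsUnit c) {d d₁ d₂ : ℕ} (hF : IsReducedCurve F d) (hd : d ≠ 0)
    (hδ₁ : IsHomogeneousDer δ₁ d₁) (hδ₂ : IsHomogeneousDer δ₂ d₂) : IsFree F := by
  have hE := euler_apply hF.1
  have h₁ : δ₁ F = 0 := h.left_mem hc
  have h₂ : δ₂ F = 0 := h.right_mem hc
  have hdu := isUnit_natCast hd
  refine ⟨3, ![1, d₁, d₂], isGradedFree_of_span ![euler, δ₁, δ₂] ?_ ?_ ?_⟩
  · refine Fintype.linearIndependent_iff.mpr fun g hg => ?_
    rw [Fin.sum_univ_three] at hg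
    have hg' : g 0 • euler + g 1 • δ₁ + g 2 • δ₂ = 0 := hg
    -- Evaluating the relation at `F` leaves only the Euler term, `g 0 * (d * F)`.
    have h0 : g 0 = 0 := by
      have h3 := DFunLike.congr_fun hg' F
      simp only [Derivation.coe_add, Derivation.coe_smul, Pi.add_apply, Pi.smul_apply,
        smul_eq_mul, hE, h₁, h₂, mul_zero, add_zero, Derivation.coe_zero, Pi.zero_apply] at h3
      exact (mul_eq_zero.mp h3).resolve_right (mul_ne_zero hdu.ne_zero hF.2.ne_zero)
    rw [h0, zero_smul, zero_add] at hg'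
    obtain ⟨h1, h2⟩ := h.pair_independent hc (pderiv_ne_zero hF hd) hg'
    intro i
    fin_cases i
    exacts [h0, h1, h2]
  · refine le_antisymm (Submodule.span_le.mpr ?_) fun δ hδ => ?_
    · rintro _ ⟨i, rfl⟩
      fin_cases i
      · exact Ideal.mem_span_singleton.mpr ⟨d, hE.trans (mul_comm _ _)⟩
      · exact Ideal.mem_span_singleton.mpr (h₁ ▸ dvd_zero F)
      · exact Ideal.mem_span_singleton.mpr (h₂ ▸ dvd_zero F)
    · obtain ⟨r, hr⟩ := Ideal.mem_span_singleton.mp hδ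
      obtain ⟨e, he⟩ := hdu.exists_left_inv
      -- If `δ F = r F`, subtracting `r / d` times the Euler derivation lands in `D₀(F)`.
      have hk : (δ - (e * r) • euler) F = 0 := by
        simp only [Derivation.coe_sub, Derivation.coe_smul, Pi.sub_apply, Pi.smul_apply,
          smul_eq_mul, hE, hr]
        linear_combination -F * r * he
      obtain ⟨s, t, hst⟩ := h.exists_eq_combination hc hF hd hk
      rw [sub_eq_iff_eq_add'.mp hst]
      exact add_mem (Submodule.smul_mem _ _ (Submodule.subset_span ⟨0, rfl⟩))
        (add_mem (Submodule.smul_mem _ _ (Submodule.subset_span ⟨1, rfl⟩))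
        (Submodule.smul_mem _ _ (Submodule.subset_span ⟨2, rfl⟩)))
  · intro i
    fin_cases i
    · intro j
      change (mkDerivation ℂ X (X j) : S).IsHomogeneous 1
      rw [mkDerivation_X]
      exact isHomogeneous_X ℂ j
    · exact hδ₁
    · exact hδ₂

/-! ### Coprimality and squarefreeness of the factors. -/

theorem not_dvd_X_X {p : S} (hp : Prime p) {i j : Fin 3} (hij : i ≠ j) (hi : p ∣ X i)
    (hj : p ∣ X j) : False := by
  have h1 := hp.associated_of_dvd (X_prime (i := i)) hi
  have h2 := h1.symm.dvd.trans hj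
  rw [X_dvd_X] at h2
  exact hij h2

theorem not_dvd_pow_pow {p : S} (hp : Prime p) {i j : Fin 3} (hij : i ≠ j) {m n : ℕ}
    (hi : p ∣ X i ^ m) (hj : p ∣ X j ^ n) : False :=
  not_dvd_X_X hp hij (hp.dvd_of_dvd_pow hi) (hp.dvd_of_dvd_pow hj)

theorem isRelPrime_of_prime {f g : S} (hf : f ≠ 0)
    (h : ∀ p : S, Prime p → p ∣ f → p ∣ g → False) : IsRelPrime f g :=
  isRelPrime_of_no_nonunits_factors (fun h0 => hf h0.1) fun q hq hq0 hqf hqg => by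
    obtain ⟨p, hp, hpq⟩ := WfDvdMonoid.exists_irreducible_factor hq hq0
    exact h p hp.prime (hpq.trans hqf) (hpq.trans hqg)

theorem X_pow_add_ne_zero {i j : Fin 3} (hij : i ≠ j) {m : ℕ} (hm : m ≠ 0) :
    (X i ^ m + X j ^ m : S) ≠ 0 := by
  intro h
  have := congrArg (eval (Pi.single i 1)) h
  simp [hm, hij.symm] at this

theorem dvd_of_dvd_succ_mul {p a : S} {n : ℕ} (h : p ∣ ((n : S) + 1) * a) : p ∣ a := by
  have := isUnit_natCast n.succ_ne_zero
  push_cast at this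
  exact this.dvd_mul_left.mp h

theorem squarefree_X_pow_add {i j : Fin 3} (hij : i ≠ j) {m : ℕ} (hm : m ≠ 0) :
    Squarefree (X i ^ m + X j ^ m : S) := by
  refine squarefree_of_pderiv (X_pow_add_ne_zero hij hm) fun p hp _ h => ?_
  obtain ⟨n, rfl⟩ := Nat.exists_eq_succ_of_ne_zero hm
  have hi := h i
  have hj := h j
  simp [Derivation.leibniz_pow, pderiv_X, hij, hij.symm] at hi hj
  exact not_dvd_pow_pow hp hij (dvd_of_dvd_succ_mul hi) (dvd_of_dvd_succ_mul hj)

theorem not_mem_vars_of_dvd {p f : S} (hf : f ≠ 0) {i : Fin 3} (hi : i ∉ f.vars) (h : p ∣ f) :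
    i ∉ p.vars := by
  obtain ⟨q, rfl⟩ := h
  rw [mem_vars_iff_degreeOf_ne_zero, not_not,
    degreeOf_mul_eq (left_ne_zero_of_mul hf) (right_ne_zero_of_mul hf)] at hi
  rw [mem_vars_iff_degreeOf_ne_zero]
  omega

/-- A common prime `p` divides `y^m + z^m`, so it does not involve `x` and is fixed by setting `x =
0`. This gives `p ∣ y^m`, hence `p ∣ x^m`. -/
theorem isRelPrime_X_pow_add (m : ℕ) (hm : m ≠ 0) :
    IsRelPrime (X 0 ^ m + X 1 ^ m : S) (X 1 ^ m + X 2 ^ m) := by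
  refine isRelPrime_of_prime (X_pow_add_ne_zero (by decide) hm) fun p hp h1 h2 => ?_
  have h0 : (0 : Fin 3) ∉ (X 1 ^ m + X 2 ^ m : S).vars := by
    intro h
    have := vars_add_subset _ _ h
    rw [Finset.mem_union] at this
    rcases this with h | h <;> simpa using vars_pow _ _ h
  have hp0 := not_mem_vars_of_dvd (X_pow_add_ne_zero (by decide) hm) h0 h2
  let φ : S →ₐ[ℂ] S := aeval (Function.update X 0 0)
  have hφ : φ p = p := by
    conv_rhs => rw [← aeval_X_left_apply p]
    refine eval₂Hom_congr' rfl (fun i hi _ => ?_) rfl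
    rw [Function.update_of_ne]
    rintro rfl
    exact hp0 hi
  have h3 := map_dvd φ h1
  rw [hφ] at h3
  have h4 : p ∣ X 1 ^ m := by simpa [φ, hm] using h3
  exact not_dvd_pow_pow hp (by decide : (0 : Fin 3) ≠ 1) ((dvd_add_left h4).mp h1) h4

theorem base_ne_zero (m : ℕ) (hm : m ≠ 0) : base m ≠ 0 := by
  intro h
  have := congrArg (eval ![1, 1, 0]) h
  simp [base, hm] at this

theorem isRelPrime_X_base {m : ℕ} (hm : m ≠ 0) {i j k : Fin 3} (hij : i ≠ j) (hik : i ≠ k)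
    (h : base m = X i ^ m * (X j ^ m + X k ^ m) + X j ^ m * X k ^ m) :
    IsRelPrime (X i) (base m) := by
  refine isRelPrime_of_prime (X_ne_zero i) fun p hp hi hb => ?_
  rw [h, dvd_add_right ((dvd_pow hi hm).mul_right _)] at hb
  rcases hp.dvd_or_dvd hb with h2 | h2
  · exact not_dvd_X_X hp hij hi (hp.dvd_of_dvd_pow h2)
  · exact not_dvd_X_X hp hik hi (hp.dvd_of_dvd_pow h2)

/-- A repeated prime divides no variable, so from the partials it divides all three pairwise sums of
`x^m, y^m, z^m`, hence two of these powers. -/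
theorem squarefree_base (m : ℕ) (hm : m ≠ 0) : Squarefree (base m) := by
  refine squarefree_of_pderiv (base_ne_zero m hm) fun p hp hb h => ?_
  obtain ⟨n, rfl⟩ : ∃ n, m = n + 1 := Nat.exists_eq_succ_of_ne_zero hm
  have d0 : p ∣ X 0 ^ n * (X 1 ^ (n + 1) + X 2 ^ (n + 1)) := by
    refine dvd_of_dvd_succ_mul (n := n) ((h 0).trans (dvd_of_eq ?_))
    simp [base, Derivation.leibniz_pow, pderiv_X]
    ring
  have d1 : p ∣ X 1 ^ n * (X 0 ^ (n + 1) + X 2 ^ (n + 1)) := by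
    refine dvd_of_dvd_succ_mul (n := n) ((h 1).trans (dvd_of_eq ?_))
    simp [base, Derivation.leibniz_pow, pderiv_X]
    ring
  have d2 : p ∣ X 2 ^ n * (X 0 ^ (n + 1) + X 1 ^ (n + 1)) := by
    refine dvd_of_dvd_succ_mul (n := n) ((h 2).trans (dvd_of_eq ?_))
    simp [base, Derivation.leibniz_pow, pderiv_X]
    ring
  have e : ∀ i : Fin 3, IsRelPrime (X i) (base (n + 1)) → ¬ p ∣ X i ^ n := fun i hi hx =>
    hp.not_isUnit (hi (hp.dvd_of_dvd_pow hx) hb)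
  have e0 := e 0 (isRelPrime_X_base hm (j := 1) (k := 2) (by decide) (by decide)
    (by rw [base]; ring))
  have e1 := e 1 (isRelPrime_X_base hm (j := 0) (k := 2) (by decide) (by decide)
    (by rw [base]; ring))
  have e2 := e 2 (isRelPrime_X_base hm (j := 0) (k := 1) (by decide) (by decide)
    (by rw [base]; ring))
  have f0 := (hp.dvd_or_dvd d0).resolve_left e0
  have f1 := (hp.dvd_or_dvd d1).resolve_left e1
  have f2 := (hp.dvd_or_dvd d2).resolve_left e2
  -- `(x^m + z^m) + (x^m + y^m) - (y^m + z^m) = 2 x^m`.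
  have g0 : p ∣ X 0 ^ (n + 1) := by
    refine dvd_of_dvd_succ_mul (n := 1) (((dvd_sub (dvd_add f1 f2) f0)).trans (dvd_of_eq ?_))
    push_cast
    ring
  exact not_dvd_pow_pow hp (by decide) g0 ((dvd_add_right g0).mp f2)

theorem isRelPrime_base_left (m : ℕ) (hm : m ≠ 0) :
    IsRelPrime (base m) (X 0 ^ m + X 1 ^ m) := by
  refine isRelPrime_of_prime (base_ne_zero m hm) fun p hp hb h => ?_
  have h1 : p ∣ X 0 ^ m * X 1 ^ m := by
    refine (dvd_add_right (h.mul_right (X 2 ^ m))).mp (hb.trans (dvd_of_eq ?_))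
    rw [base]
    ring
  rcases hp.dvd_or_dvd h1 with h2 | h2
  · exact not_dvd_pow_pow hp (by decide) h2 ((dvd_add_right h2).mp h)
  · exact not_dvd_pow_pow hp (by decide) h2 ((dvd_add_left h2).mp h)

theorem isRelPrime_base_right (m : ℕ) (hm : m ≠ 0) :
    IsRelPrime (base m) (X 1 ^ m + X 2 ^ m) := by
  refine isRelPrime_of_prime (base_ne_zero m hm) fun p hp hb h => ?_
  have h1 : p ∣ X 1 ^ m * X 2 ^ m := by
    refine (dvd_add_right (h.mul_right (X 0 ^ m))).mp (hb.trans (dvd_of_eq ?_))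
    rw [base]
    ring
  rcases hp.dvd_or_dvd h1 with h2 | h2
  · exact not_dvd_pow_pow hp (by decide) h2 ((dvd_add_right h2).mp h)
  · exact not_dvd_pow_pow hp (by decide) h2 ((dvd_add_left h2).mp h)

/-! ### Degrees and reducedness of the two curves. -/

theorem isHomogeneous_natCast (k : ℕ) : (k : S).IsHomogeneous 0 := by
  simpa using isHomogeneous_C (Fin 3) (k : ℂ)

theorem isHomogeneous_pow_add (i j : Fin 3) (m : ℕ) :
    (X i ^ m + X j ^ m : S).IsHomogeneous m :=
  (isHomogeneous_X_pow i m).add (isHomogeneous_X_pow j m)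

theorem isHomogeneous_base (m : ℕ) : (base m).IsHomogeneous (2 * m) := by
  rw [two_mul]
  exact (((isHomogeneous_X_pow 0 m).mul (isHomogeneous_X_pow 1 m)).add
    ((isHomogeneous_X_pow 1 m).mul (isHomogeneous_X_pow 2 m))).add
    ((isHomogeneous_X_pow 0 m).mul (isHomogeneous_X_pow 2 m))

theorem isReducedCurve_left (m : ℕ) (hm : m ≠ 0) :
    IsReducedCurve (base m * (X 0 ^ m + X 1 ^ m) * (X 1 ^ m + X 2 ^ m)) (4 * m) := by
  refine ⟨?_, ?_⟩
  · have := ((isHomogeneous_base m).mul (isHomogeneous_pow_add 0 1 m)).mul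
      (isHomogeneous_pow_add 1 2 m)
    convert this using 1
    ring
  · rw [squarefree_mul_iff, squarefree_mul_iff]
    exact ⟨(isRelPrime_base_right m hm).mul_left (isRelPrime_X_pow_add m hm),
      ⟨isRelPrime_base_left m hm, squarefree_base m hm, squarefree_X_pow_add (by decide) hm⟩,
      squarefree_X_pow_add (by decide) hm⟩

theorem isReducedCurve_right (m : ℕ) (hm : m ≠ 0) :
    IsReducedCurve (X 1 * X 2 * base m * (X 1 ^ m + X 2 ^ m)) (3 * m + 2) := by
  refine ⟨?_, ?_⟩
  · have := (((isHomogeneous_X ℂ 1).mul (isHomogeneous_X ℂ 2)).mul (isHomogeneous_base m)).mul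
      (isHomogeneous_pow_add 1 2 m)
    convert this using 1
    ring
  · have h12 : IsRelPrime (X 1 : S) (X 2) :=
      isRelPrime_of_prime (X_ne_zero 1) fun p hp h1 h2 => not_dvd_X_X hp (by decide) h1 h2
    have h1b : IsRelPrime (X 1 : S) (base m) :=
      isRelPrime_X_base hm (j := 0) (k := 2) (by decide) (by decide) (by rw [base]; ring)
    have h2b : IsRelPrime (X 2 : S) (base m) :=
      isRelPrime_X_base hm (j := 0) (k := 1) (by decide) (by decide) (by rw [base]; ring)
    have h1l : IsRelPrime (X 1 : S) (X 1 ^ m + X 2 ^ m) :=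
      isRelPrime_of_prime (X_ne_zero 1) fun p hp h1 h2 => not_dvd_X_X hp (by decide) h1
        (hp.dvd_of_dvd_pow ((dvd_add_right (dvd_pow h1 hm)).mp h2))
    have h2l : IsRelPrime (X 2 : S) (X 1 ^ m + X 2 ^ m) :=
      isRelPrime_of_prime (X_ne_zero 2) fun p hp h1 h2 => not_dvd_X_X hp (by decide) h1
        (hp.dvd_of_dvd_pow ((dvd_add_left (dvd_pow h1 hm)).mp h2))
    rw [squarefree_mul_iff, squarefree_mul_iff, squarefree_mul_iff]
    exact ⟨(h1l.mul_left h2l).mul_left (isRelPrime_base_right m hm),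
      ⟨h1b.mul_left h2b, ⟨h12, X_prime.squarefree, X_prime.squarefree⟩, squarefree_base m hm⟩,
      squarefree_X_pow_add (by decide) hm⟩

/-! ### The explicit bases of `D₀`. -/

theorem isHomogeneousDer_mkDerivation {a b c : S} {k : ℕ} (ha : a.IsHomogeneous k)
    (hb : b.IsHomogeneous k) (hc : c.IsHomogeneous k) :
    IsHomogeneousDer (mkDerivation ℂ ![a, b, c]) k := by
  intro i
  rw [mkDerivation_X]
  fin_cases i
  exacts [ha, hb, hc]

/-- With `P = (x^m + y^m)(y^m + z^m)` and `m = n + 1`, `base m = P - y^(2m)`, so `F = P² - P y^(2m)`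
depends only on `P` and `y`. The first derivation is `P_z ∂x - P_x ∂z`, killing both; the second
sends `y` to `∂F/∂P = 2P - y^(2m)` and `P` to `2m y^(2m-1) P`, minus the derivative of `F` in `y` at
fixed `P`. -/
theorem crossEqGradient_left (n : ℕ) :
    CrossEqGradient
      (base (n + 1) * (X 0 ^ (n + 1) + X 1 ^ (n + 1)) * (X 1 ^ (n + 1) + X 2 ^ (n + 1)))
      (mkDerivation ℂ ![((n + 1 : ℕ) : S) * (X 2 ^ n * (X 0 ^ (n + 1) + X 1 ^ (n + 1))), 0,
        -(((n + 1 : ℕ) : S) * (X 0 ^ n * (X 1 ^ (n + 1) + X 2 ^ (n + 1))))])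
      (mkDerivation ℂ ![-(X 1 ^ n * X 0 *
          (((2 : ℕ) : S) * X 0 ^ (n + 1) + ((3 : ℕ) : S) * X 1 ^ (n + 1))),
        ((2 : ℕ) : S) * ((X 0 ^ (n + 1) + X 1 ^ (n + 1)) * (X 1 ^ (n + 1) + X 2 ^ (n + 1))) -
          X 1 ^ (n + 1) * X 1 ^ (n + 1),
        -(X 1 ^ n * X 2 *
          (((2 : ℕ) : S) * X 2 ^ (n + 1) + ((3 : ℕ) : S) * X 1 ^ (n + 1)))]) 1 := by
  constructor <;>
  · simp [mkDerivation_X, base, Derivation.leibniz_pow, pderiv_X]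
    ring

/-- With `m = n + 1`, the first derivation multiplies `yz`, `base m` and `y^m + z^m` by `m`, `m²`
and `-m(m+1)` times `y^m - z^m`, which sum to zero. The second is `(∂x base) E - (3m+2) base ∂x`,
with `E` the Euler derivation; it kills `F` because `deg F = 3m+2 = 3n+5` and the other factors do
not involve `x`. -/
theorem crossEqGradient_right (n : ℕ) :
    CrossEqGradient (X 1 * X 2 * base (n + 1) * (X 1 ^ (n + 1) + X 2 ^ (n + 1)))
      (mkDerivation ℂ ![X 0 * (((2 * n + 3 : ℕ) : S) * X 1 ^ (n + 1) -
          ((2 * n + 3 : ℕ) : S) * X 2 ^ (n + 1)),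
        X 1 * (-(((n + 2 : ℕ) : S) * X 1 ^ (n + 1)) - ((2 * n + 3 : ℕ) : S) * X 2 ^ (n + 1)),
        X 2 * (((2 * n + 3 : ℕ) : S) * X 1 ^ (n + 1) + ((n + 2 : ℕ) : S) * X 2 ^ (n + 1))])
      (mkDerivation ℂ ![((n + 1 : ℕ) : S) * (X 0 ^ (n + 1) * (X 1 ^ (n + 1) + X 2 ^ (n + 1))) -
          ((3 * n + 5 : ℕ) : S) * base (n + 1),
        ((n + 1 : ℕ) : S) * (X 0 ^ n * X 1 * (X 1 ^ (n + 1) + X 2 ^ (n + 1))),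
        ((n + 1 : ℕ) : S) * (X 0 ^ n * X 2 * (X 1 ^ (n + 1) + X 2 ^ (n + 1)))])
      (-((3 * n + 5 : ℕ) : S)) := by
  constructor <;>
  · simp [mkDerivation_X, base, Derivation.leibniz_pow, pderiv_X]
    ring

end PlaneCurve

open PlaneCurve in
theorem mainTheorem5 (m : ℕ) (hm : 2 ≤ m) :
    (∀ F' : PlaneCurve.S,
      F' = PlaneCurve.base m * (X 0 ^ m + X 1 ^ m) * (X 1 ^ m + X 2 ^ m) →
        PlaneCurve.IsReducedCurve F' (4 * m) ∧ PlaneCurve.IsFree F' ∧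
          PlaneCurve.HasExponents F' (2 * m - 1) (2 * m)) ∧
    (∀ F'' : PlaneCurve.S,
      F'' = X 1 * X 2 * PlaneCurve.base m * (X 1 ^ m + X 2 ^ m) →
        PlaneCurve.IsReducedCurve F'' (3 * m + 2) ∧ PlaneCurve.IsFree F'' ∧
          PlaneCurve.HasExponents F'' (m + 1) (2 * m)) := by
  -- Partials of `m`-th powers involve the exponent `m - 1`, which becomes `n`.
  obtain ⟨n, rfl⟩ : ∃ n, m = n + 1 := ⟨m - 1, by omega⟩
  have hX := fun (i : Fin 3) (k : ℕ) => isHomogeneous_X_pow (R := ℂ) i k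
  have hN : ∀ (k : ℕ) {f : S} {d : ℕ}, f.IsHomogeneous d → ((k : S) * f).IsHomogeneous d :=
    fun k f d hf => by simpa using (isHomogeneous_natCast k).mul hf
  have hL := fun i j : Fin 3 => isHomogeneous_pow_add i j (n + 1)
  have cast : ∀ {f : S} {d e : ℕ}, f.IsHomogeneous d → d = e → f.IsHomogeneous e :=
    fun hf h => h ▸ hf
  refine ⟨?_, ?_⟩
  · rintro _ rfl
    have hF := isReducedCurve_left (n + 1) n.succ_ne_zero
    have h := crossEqGradient_left n
    have h₁ := isHomogeneousDer_mkDerivation (k := 2 * (n + 1) - 1)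
      (cast (hN (n + 1) ((hX 2 n).mul (hL 0 1))) (by omega)) (isHomogeneous_zero _ _ _)
      (cast (hN (n + 1) ((hX 0 n).mul (hL 1 2))).neg (by omega))
    have h₂ := isHomogeneousDer_mkDerivation (k := 2 * (n + 1))
      (cast (((hX 1 n).mul (isHomogeneous_X ℂ 0)).mul
        ((hN 2 (hX 0 (n + 1))).add (hN 3 (hX 1 (n + 1))))).neg (by omega))
      (cast ((hN 2 ((hL 0 1).mul (hL 1 2))).sub ((hX 1 (n + 1)).mul (hX 1 (n + 1)))) (by omega))
      (cast (((hX 1 n).mul (isHomogeneous_X ℂ 2)).mul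
        ((hN 2 (hX 2 (n + 1))).add (hN 3 (hX 1 (n + 1))))).neg (by omega))
    exact ⟨hF, h.isFree isUnit_one hF (by omega) h₁ h₂,
      h.hasExponents isUnit_one hF (by omega) h₁ h₂⟩
  · rintro _ rfl
    have hF := isReducedCurve_right (n + 1) n.succ_ne_zero
    have h := crossEqGradient_right n
    have hc := (isUnit_natCast (d := 3 * n + 5) (by omega)).neg
    have h₁ := isHomogeneousDer_mkDerivation (k := n + 1 + 1)
      (cast ((isHomogeneous_X ℂ 0).mul ((hN (2 * n + 3) (hX 1 (n + 1))).sub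
        (hN (2 * n + 3) (hX 2 (n + 1))))) (by omega))
      (cast ((isHomogeneous_X ℂ 1).mul ((hN (n + 2) (hX 1 (n + 1))).neg.sub
        (hN (2 * n + 3) (hX 2 (n + 1))))) (by omega))
      (cast ((isHomogeneous_X ℂ 2).mul ((hN (2 * n + 3) (hX 1 (n + 1))).add
        (hN (n + 2) (hX 2 (n + 1))))) (by omega))
    have h₂ := isHomogeneousDer_mkDerivation (k := 2 * (n + 1))
      (cast ((hN (n + 1) ((hX 0 (n + 1)).mul (hL 1 2))).sub (hN (3 * n + 5)
        (cast (isHomogeneous_base (n + 1)) (by omega)))) (by omega))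
      (cast (hN (n + 1) (((hX 0 n).mul (isHomogeneous_X ℂ 1)).mul (hL 1 2))) (by omega))
      (cast (hN (n + 1) (((hX 0 n).mul (isHomogeneous_X ℂ 2)).mul (hL 1 2))) (by omega))
    exact ⟨hF, h.isFree hc hF (by omega) h₁ h₂, h.hasExponents hc hF (by omega) h₁ h₂⟩
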